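/- \textbf{Setting.} Let $K\ge 1$ and $\mathcal K=\{1,\dots,K\}$. On a probability space $(\Omega,\mathcal F,\mathbb P)$ let $\{(U_n,C_n,D_n)\}_{n\in\mathbb Z}$ be a marked point process: $U_n$ is the time at which the $n$th service is completed, $C_n\in\mathcal K$ is the source of the packet completed at $U_n$, and $D_n\in[0,\infty]$ is its delay. Let $\Psi=\sum_n\delta_{U_n}$ and $\Psi_k=\sum_{n:\,C_n=k}\delta_{U_n}$. Assume: (i) almost surely $\Psi$ is simple and locally finite, and numbered so that $\cdots<U_{-1}<U_0\le 0<U_1<\cdots$ with $U_n\to\pm\infty$ as $n\to\pm\infty$; (ii) the marked point process is stationary, that is, for every $t\in\mathbb R$ the sequence $\{(U_{\Psi(0,t]+n}-t,\,C_{\Psi(0,t]+n},\,D_{\Psi(0,t]+n})\}_{n\in\mathbb Z}$, with $\Psi(0,t]=-\Psi(t,0]$ for $t<0$, has the same law as $\{(U_n,C_n,D_n)\}_{n\in\mathbb Z}$; (iii) the intensity $\lambda_\Psi=\mathbb E[\Psi(0,1]]$ satisfies $0<\lambda_\Psi<\infty$; (iv) $\mathbb P_\Psi^0(C_0=k)>0$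 for all $k\in\mathcal K$; (v) $\mathbb P_{\Psi_k}^0(D_0<\infty)=1$ for all $k\in\mathcal K$; (vi) for every $k\in\mathcal K$, almost surely $\Psi_k$ has at least one point. Here, for $\Phi\in\{\Psi,\Psi_1,\dots,\Psi_K\}$, the Palm probability $\mathbb P_\Phi^0$ is the law on sequences given by $$\mathbb P_\Phi^0(A)=\frac{1}{\mathbb E[\Phi(0,1]]}\,\mathbb E\Big[\sum_{n:\,U_n\text{ is a point of }\Phi}\mathbf 1\{U_n\in(0,1]\}\,\mathbf 1\big\{\{(U_{n+j}-U_n,C_{n+j},D_{n+j})\}_{j\in\mathbb Z}\in A\big\}\Big],$$ and $\mathbb E_\Psi^0$ is the expectation under $\mathbb P_\Psi^0$. For $k\in\mathcal K$ and $t\in\mathbb R$ the age of information is $A_k(t)=D+t-U$, where $U$ is the last point of $\Psi_k$ in $(-\infty,t]$ and $D$ is the delay of the packet completed at $U$; for $t=0$ these are denoted $U_{k,0}$ and $D_{k,0}$. Let $(\eta_1,\dots,\eta_K)$ be the random permutation of $\mathcal K$ with $U_{\eta_1,0}>U_{\eta_2,0}>\cdots>U_{\eta_K,0}$. For $\boldsymbol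 s=(s_1,\dots,s_K)\in\mathbb R^K$ put $\bar s=\sum_{i=1}^K s_i$, $\bar s_{\eta[k]}=\sum_{j=k}^{K}s_{\eta_j}$ and $$\mathcal L_{\boldsymbol A}(\boldsymbol s)=\mathbb E\Big[\exp\Big(-\sum_{k=1}^K s_kA_k(0)\Big)\Big].$$ \textbf{Theorem.} For every $\boldsymbol s\in\mathbb R^K$ such that the expectation on the right-hand side exists (that is, its integrand is $\mathbb P_\Psi^0$-integrable), $$\bar s\,\mathcal L_{\boldsymbol A}(\boldsymbol s)=\lambda_\Psi\,\mathbb E_\Psi^0\Big[\big(1-e^{-\bar sU_1}\big)\prod_{k=1}^{K-1}\exp\Big\{-s_{\eta_k}D_{\eta_k,0}-\bar s_{\eta[k+1]}\,(U_{\eta_k,0}-U_{\eta_{k+1},0})\Big\}\exp\big(-s_{\eta_K}D_{\eta_K,0}\big)\Big],$$ where for $\bar s=0$ the left-hand side is read as $0$ even if $\mathcal L_{\boldsymbol A}(\boldsymbol s)=\infty$. If $\bar s\ne 0$, then $\mathcal L_{\boldsymbol A}(\boldsymbol s)$ is finite if and only if the expectation on the right-hand side exists. -/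

import Mathlib

open MeasureTheory ProbabilityTheory
open scoped ENNReal

namespace AoI

/-- A numbered realization of a marked point process on the real line:
`x n = (U_n, C_n, D_n)`, where `U_n` is the `n`-th service completion time, `C_n` the source of the
packet completed at `U_n`, and `D_n` its delay.  It carries the product `σ`-algebra. -/
abbrev Path (K : ℕ) : Type := ℤ → ℝ × Fin K × ℝ≥0∞

namespace Path

variable {K : ℕ}

/-- The service completion time `U_n`. -/
def time (x : Path K) (n : ℤ) : ℝ := (x n).1

/-- The source `C_n`. -/
def source (x : Path K) (n : ℤ) : Fin K := (x n).2.1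

/-- The delay `D_n`. -/
def delay (x : Path K) (n : ℤ) : ℝ≥0∞ := (x n).2.2

/-- The realization is simple and locally finite, and is numbered so that
`⋯ < U_{-1} < U_0 ≤ 0 < U_1 < ⋯`. -/
structure IsNumbered (x : Path K) : Prop where
  strictMono : StrictMono x.time
  nonpos : x.time 0 ≤ 0
  pos : 0 < x.time 1
  tendsto_atTop : Filter.Tendsto x.time Filter.atTop Filter.atTop
  tendsto_atBot : Filter.Tendsto x.time Filter.atBot Filter.atBot

/-- The point measure counting the service completions of packets from the sources in `I`.
It is `Ψ` for `I = Set.univ`, and `Ψ_k` for `I = {k}`. -/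
noncomputable def pointMeasure (x : Path K) (I : Set (Fin K)) : Measure ℝ :=
  Measure.sum fun n : {n : ℤ // x.source n ∈ I} => Measure.dirac (x.time n)

/-- The signed number of points `Ψ(0, t]`, with `Ψ(0, t] = -Ψ(t, 0]` for `t < 0`. -/
noncomputable def count (x : Path K) (t : ℝ) : ℤ :=
  if 0 ≤ t then ({n : ℤ | x.time n ∈ Set.Ioc 0 t}.ncard : ℤ)
  else -({n : ℤ | x.time n ∈ Set.Ioc t 0}.ncard : ℤ)

/-- The realization seen from time `t`: its `n`-th entry is
`(U_{Ψ(0,t]+n} - t, C_{Ψ(0,t]+n}, D_{Ψ(0,t]+n})`. -/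
noncomputable def shift (t : ℝ) (x : Path K) : Path K := fun n =>
  (x.time (x.count t + n) - t, x.source (x.count t + n), x.delay (x.count t + n))

/-- The realization seen from its `n`-th point (which gets number `0`). -/
def recenter (n : ℤ) (x : Path K) : Path K := fun m =>
  (x.time (n + m) - x.time n, x.source (n + m), x.delay (n + m))

/-- The number of the latest service completion of a source `k` packet at or before time `t`. -/
noncomputable def lastIndex (x : Path K) (k : Fin K) (t : ℝ) : ℤ :=
  sSup {n : ℤ | x.source n = k ∧ x.time n ≤ t}

/-- The age of information of source `k` at time `t`: `A_k(t) = D_{k,n} + t - U_{k,n}` where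
`U_{k,n}` is the latest source `k` completion time at or before `t`. -/
noncomputable def age (x : Path K) (k : Fin K) (t : ℝ) : ℝ≥0∞ :=
  x.delay (x.lastIndex k t) + ENNReal.ofReal (t - x.time (x.lastIndex k t))

/-- `U_{k,0}`, the time of the latest update of monitor `k` at or before time `0`. -/
noncomputable def lastTime (x : Path K) (k : Fin K) : ℝ := x.time (x.lastIndex k 0)

/-- `D_{k,0}`, the delay of the source `k` packet completed at `U_{k,0}`, as a real number. -/
noncomputable def lastDelay (x : Path K) (k : Fin K) : ℝ := (x.delay (x.lastIndex k 0)).toReal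

/-- The random permutation `η` that lists the monitors by recency of update,
`U_{η_1,0} > U_{η_2,0} > ⋯ > U_{η_K,0}`. -/
noncomputable def eta (x : Path K) : Equiv.Perm (Fin K) :=
  Tuple.sort fun k => -x.lastTime k

end Path

section Law

variable {Ω : Type*} [MeasurableSpace Ω] {K : ℕ}

/-- The intensity `E[Ψ_I(0, 1]]` of the point process of the sources in `I`. -/
noncomputable def intensity (P : Measure Ω) (X : Ω → Path K) (I : Set (Fin K)) : ℝ≥0∞ :=
  ∫⁻ ω, (X ω).pointMeasure I (Set.Ioc 0 1) ∂P

/-- The Palm probability for the point process `Ψ_I` of the sources in `I`, as a law on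
realizations: it gives a set `A` the mass
`λ_I⁻¹ E[∑_n 1{U_n ∈ (0, 1], C_n ∈ I} 1{the process seen from U_n is in A}]`.
It is `P_Ψ^0` for `I = Set.univ`, and `P_{Ψ_k}^0` for `I = {k}`. -/
noncomputable def palm (P : Measure Ω) (X : Ω → Path K) (I : Set (Fin K)) : Measure (Path K) :=
  (intensity P X I)⁻¹ • Measure.sum fun n : ℤ =>
    (P.restrict {ω | (X ω).time n ∈ Set.Ioc 0 1 ∧ (X ω).source n ∈ I}).map
      fun ω => (X ω).recenter n

/-- The standing assumption on the marked point process `{(U_n, C_n, D_n)}`. -/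
structure IsStationarySystem (P : Measure Ω) (X : Ω → Path K) : Prop where
  measurable : Measurable X
  simple : ∀ᵐ ω ∂P, (X ω).IsNumbered
  stationary : ∀ t : ℝ, IdentDistrib (fun ω => (X ω).shift t) X P P
  intensity_pos : 0 < intensity P X Set.univ
  intensity_lt_top : intensity P X Set.univ < ∞
  source_pos : ∀ k : Fin K, 0 < palm P X Set.univ {x | x.source 0 = k}
  delay_finite : ∀ k : Fin K, palm P X {k} {x | x.delay 0 < ∞} = 1

end Law

/-- The integrand of the right-hand side: with `K = m + 1` sources,
`(1 - e^{-s̄ U_1}) ∏_{k=1}^{K-1} exp(-s_{η_k} D_{η_k,0} - s̄_{η[k+1]} (U_{η_k,0} - U_{η_{k+1},0}))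
  · exp(-s_{η_K} D_{η_K,0})`.
Sources and positions are numbered from `0`, so position `k` of the formula is `k.castSucc`,
position `k + 1` is `k.succ`, and position `K` is `Fin.last m`. -/
noncomputable def jointIntegrand {m : ℕ} (s : Fin (m + 1) → ℝ) (x : Path (m + 1)) : ℝ :=
  (1 - Real.exp (-(∑ i, s i) * x.time 1)) *
    (∏ k : Fin m, Real.exp
      (-s (x.eta k.castSucc) * x.lastDelay (x.eta k.castSucc)
        - (∑ j ∈ Finset.Ici k.succ, s (x.eta j)) *
          (x.lastTime (x.eta k.castSucc) - x.lastTime (x.eta k.succ)))) *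
    Real.exp (-s (x.eta (Fin.last m)) * x.lastDelay (x.eta (Fin.last m)))

end AoI

/-! The proof rests on Palm inversion. `pointLaw` is the Campbell measure: the intensity of the
pairs (point, realization seen from it). By stationarity its sections over a fixed set of
realizations are translation invariant on the line, and they are finite on `(0, 1]`. Hence they are
multiples of Lebesgue measure, and `pointLaw = volume ⊗ palmMass` (`pointLaw_eq_prod`). Testing this
on pairs for which the origin lies between the point and its successor, a condition met by point `0`
alone, gives `lintegral_eq_lintegral_palmMass`.

Moving the points by `t` with `-U_1 < t ≤ 0` carries none of them across the origin, so every age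
changes by `-t`. The weighted sum of the ages is thus affine in `t` with slope `-s̄`, and the
integral of its negative exponential produces `(1 - e^{-s̄ U_1}) / s̄`. Abel summation along `η`
identifies the remaining factor with the product in the theorem.

For `s̄ ≠ 0` both sides, divided by `s̄`, are integrals of nonnegative functions. The identity
therefore holds in `[0, ∞]`, which yields the integrability equivalence as well as the formula. -/

namespace AoI

/-! ### Measurability of path functionals -/

namespace Path

variable {K : ℕ}

lemma measurable_time (n : ℤ) : Measurable fun x : Path K => x.time n :=
  (measurable_pi_apply n).fst

lemma measurable_source (n : ℤ) : Measurable fun x : Path K => x.source n :=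
  (measurable_pi_apply n).snd.fst

lemma measurable_delay (n : ℤ) : Measurable fun x : Path K => x.delay n :=
  (measurable_pi_apply n).snd.snd

lemma measurable_recenter (n : ℤ) : Measurable fun x : Path K => x.recenter n :=
  measurable_pi_lambda _ fun _ => ((measurable_time _).sub (measurable_time _)).prodMk
    ((measurable_source _).prodMk (measurable_delay _))

lemma recenter_shift (n : ℤ) (t : ℝ) (x : Path K) :
    (x.shift t).recenter n = x.recenter (x.count t + n) := by
  funext m
  simp [recenter, shift, time, source, delay, add_assoc]

/-- The realization with all service completion times moved by `t`, and the same numbering. -/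
def translate (t : ℝ) (x : Path K) : Path K := fun n => (x.time n + t, x.source n, x.delay n)

lemma measurable_translate : Measurable fun p : ℝ × Path K => p.2.translate p.1 :=
  measurable_pi_lambda _ fun n => (((measurable_time n).comp measurable_snd).add
    measurable_fst).prodMk (((measurable_source n).comp measurable_snd).prodMk
      ((measurable_delay n).comp measurable_snd))

lemma translate_recenter_zero (x : Path K) : (x.recenter 0).translate (x.time 0) = x := by
  funext m
  simp [recenter, translate, time, source, delay]

lemma isGreatest_iff (x : Path K) (k : Fin K) (t : ℝ) (n : ℤ) :
    IsGreatest {n : ℤ | x.source n = k ∧ x.time n ≤ t} n ↔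
      (x.source n = k ∧ x.time n ≤ t) ∧ ∀ j, n < j → ¬ (x.source j = k ∧ x.time j ≤ t) := by
  refine and_congr_right fun _ => ⟨fun h j hj hm => absurd (h hm) (not_le.2 hj), fun h j hj => ?_⟩
  by_contra hlt
  exact h j (not_le.1 hlt) hj

/-- The second alternative is the default value `0` of `sSup` on empty or unbounded sets of
integers. Including it gives measurability on all paths, not just almost all. -/
lemma lastIndex_eq_iff (x : Path K) (k : Fin K) (t : ℝ) (n : ℤ) :
    x.lastIndex k t = n ↔ IsGreatest {n : ℤ | x.source n = k ∧ x.time n ≤ t} n ∨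
      (n = 0 ∧ ∀ j, ¬ IsGreatest {n : ℤ | x.source n = k ∧ x.time n ≤ t} j) := by
  unfold lastIndex
  set S := {n : ℤ | x.source n = k ∧ x.time n ≤ t}
  by_cases h : ∃ j, IsGreatest S j
  · obtain ⟨j, hj⟩ := h
    rw [hj.csSup_eq]
    constructor
    · rintro rfl
      exact Or.inl hj
    · rintro (h | h)
      · exact hj.unique h
      · exact absurd hj (h.2 j)
  · have h0 : sSup S = 0 := by
      by_cases hne : S.Nonempty
      · by_cases hb : BddAbove S
        · exact absurd ⟨_, Int.csSup_mem hne hb, fun a ha => le_csSup hb ha⟩ h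
        · exact Int.csSup_of_not_bddAbove hb
      · rw [Set.not_nonempty_iff_eq_empty.1 hne]
        exact Int.csSup_empty
    push Not at h
    rw [h0]
    constructor
    · rintro rfl
      exact Or.inr ⟨rfl, h⟩
    · rintro (h' | h')
      · exact absurd h' (h n)
      · exact h'.1.symm

lemma measurable_lastIndex (k : Fin K) (t : ℝ) : Measurable fun x : Path K => x.lastIndex k t := by
  have hS (n : ℤ) : MeasurableSet {x : Path K | x.source n = k ∧ x.time n ≤ t} :=
    (measurable_source n (measurableSet_singleton k)).inter
      (measurable_time n measurableSet_Iic)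
  have hG (n : ℤ) : MeasurableSet
      {x : Path K | IsGreatest {n : ℤ | x.source n = k ∧ x.time n ≤ t} n} := by
    have : {x : Path K | IsGreatest {n : ℤ | x.source n = k ∧ x.time n ≤ t} n} =
        {x | x.source n = k ∧ x.time n ≤ t} ∩
          ⋂ j, ⋂ _ : n < j, {x | x.source j = k ∧ x.time j ≤ t}ᶜ := by
      ext x
      simp only [Set.mem_inter_iff, Set.mem_iInter]
      exact isGreatest_iff x k t n
    rw [this]
    exact (hS n).inter (MeasurableSet.iInter fun j => MeasurableSet.iInter fun _ => (hS j).compl)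
  refine measurable_to_countable' fun n => ?_
  have : (fun x : Path K => x.lastIndex k t) ⁻¹' {n} =
      {x : Path K | IsGreatest {n : ℤ | x.source n = k ∧ x.time n ≤ t} n} ∪ ({_x | n = 0} ∩
        ⋂ j, {x : Path K | IsGreatest {n : ℤ | x.source n = k ∧ x.time n ≤ t} j}ᶜ) := by
    ext x
    simp only [Set.mem_union, Set.mem_inter_iff, Set.mem_iInter]
    exact lastIndex_eq_iff x k t n
  rw [this]
  exact (hG n).union ((MeasurableSet.const _).inter (MeasurableSet.iInter fun j => (hG j).compl))

lemma measurable_age (k : Fin K) (t : ℝ) : Measurable fun x : Path K => x.age k t := by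
  have hd : Measurable fun p : Path K × ℤ => p.1.delay p.2 :=
    measurable_from_prod_countable_left measurable_delay
  have ht : Measurable fun p : Path K × ℤ => p.1.time p.2 :=
    measurable_from_prod_countable_left measurable_time
  have hp : Measurable fun x : Path K => (x, x.lastIndex k t) :=
    measurable_id.prodMk (measurable_lastIndex k t)
  exact (hd.comp hp).add ((measurable_const.sub (ht.comp hp)).ennreal_ofReal)

/-- A realization with a point at the origin, in which every source has completed a service and
all delays are finite. -/
structure IsTypical (x : Path K) : Prop where
  time_zero : x.time 0 = 0
  strictMono : StrictMono x.time
  exists_source : ∀ k, ∃ n, x.source n = k ∧ x.time n ≤ 0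
  delay_lt_top : ∀ n, x.delay n < ∞

lemma measurableSet_isTypical : MeasurableSet {x : Path K | x.IsTypical} := by
  have : {x : Path K | x.IsTypical} = {x | x.time 0 = 0} ∩ (⋂ i : ℤ, ⋂ j : ℤ, ⋂ _ : i < j,
      {x | x.time i < x.time j}) ∩ (⋂ k : Fin K, ⋃ n : ℤ, {x | x.source n = k ∧ x.time n ≤ 0}) ∩
      ⋂ n : ℤ, {x | x.delay n < ∞} := by
    ext x
    simp only [Set.mem_inter_iff, Set.mem_iInter, Set.mem_iUnion, Set.mem_ofPred_eq]
    exact ⟨fun h => ⟨⟨⟨h.1, fun i j hij => h.2 hij⟩, h.3⟩, h.4⟩,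
      fun h => ⟨h.1.1.1, fun i j hij => h.1.1.2 i j hij, h.1.2, h.2⟩⟩
  rw [this]
  refine (((measurable_time 0 (measurableSet_singleton 0)).inter ?_).inter ?_).inter ?_
  · exact MeasurableSet.iInter fun i => MeasurableSet.iInter fun j => MeasurableSet.iInter fun _ =>
      measurableSet_lt (measurable_time i) (measurable_time j)
  · exact MeasurableSet.iInter fun k => MeasurableSet.iUnion fun n =>
      (measurable_source n (measurableSet_singleton k)).inter
        (measurable_time n measurableSet_Iic)
  · exact MeasurableSet.iInter fun n => measurable_delay n measurableSet_Iio

/-! ### Last updates and ages on typical realizations -/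

namespace IsTypical

variable {x : Path K}

lemma isGreatest_lastIndex (hx : x.IsTypical) (k : Fin K) :
    IsGreatest {n : ℤ | x.source n = k ∧ x.time n ≤ 0} (x.lastIndex k 0) := by
  have hb : BddAbove {n : ℤ | x.source n = k ∧ x.time n ≤ 0} := ⟨0, fun n hn => by
    rw [← hx.strictMono.le_iff_le, hx.time_zero]
    exact hn.2⟩
  exact ⟨Int.csSup_mem (hx.exists_source k) hb, fun a ha => le_csSup hb ha⟩

lemma lastTime_nonpos (hx : x.IsTypical) (k : Fin K) : x.lastTime k ≤ 0 :=
  (hx.isGreatest_lastIndex k).1.2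

lemma lastTime_source_zero (hx : x.IsTypical) : x.lastTime (x.source 0) = 0 := by
  refine le_antisymm (hx.lastTime_nonpos _) ?_
  rw [← hx.time_zero]
  exact hx.strictMono.monotone ((hx.isGreatest_lastIndex _).2 ⟨rfl, hx.time_zero.le⟩)

lemma toReal_age_translate (hx : x.IsTypical) (k : Fin K) {t : ℝ} (ht : t ≤ 0)
    (ht' : 0 < x.time 1 + t) :
    ((x.translate t).age k 0).toReal = x.lastDelay k - x.lastTime k - t := by
  have hidx : (x.translate t).lastIndex k 0 = x.lastIndex k 0 := by
    unfold lastIndex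
    congr 1
    ext n
    refine and_congr_right fun _ => ?_
    change x.time n + t ≤ 0 ↔ x.time n ≤ 0
    constructor
    · intro h
      by_contra hn
      have h1 : 0 < n := by
        rw [← hx.strictMono.lt_iff_lt, hx.time_zero]
        exact not_le.1 hn
      have := hx.strictMono.monotone (show (1 : ℤ) ≤ n from h1)
      linarith
    · intro h
      linarith
  have hl := hx.lastTime_nonpos k
  rw [age, hidx]
  change (x.delay _ + ENNReal.ofReal (0 - (x.lastTime k + t))).toReal = _
  rw [ENNReal.toReal_add (hx.delay_lt_top _).ne ENNReal.ofReal_ne_top,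
    ENNReal.toReal_ofReal (by linarith), lastDelay]
  ring

end IsTypical

end Path

/-- Abel summation: `a j` multiplies every gap up to position `j`, and these gaps telescope to `u 0
- u j`. -/
lemma sum_sum_Ici_mul_sub {m : ℕ} (a u : Fin (m + 1) → ℝ) :
    ∑ k : Fin m, (∑ j ∈ Finset.Ici k.succ, a j) * (u k.castSucc - u k.succ) =
      ∑ k, a k * (u 0 - u k) := by
  have hIci {n : ℕ} (b : Fin (n + 1) → ℝ) (i : Fin (n + 1)) :
      ∑ j ∈ Finset.Ici i, b j = ∑ j, if i ≤ j then b j else 0 := by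
    rw [← Finset.sum_filter]
    congr 1
    ext j
    simp
  induction m with
  | zero => simp
  | succ m ih =>
    have ih' := ih (fun k => a k.succ) fun k => u k.succ
    simp only [hIci] at ih' ⊢
    rw [Fin.sum_univ_succ]
    have hterm (k : Fin m) :
        (∑ j, if k.succ.succ ≤ j then a j else 0) * (u k.succ.castSucc - u k.succ.succ) =
          (∑ j : Fin (m + 1), if k.succ ≤ j then a j.succ else 0) *
            (u k.castSucc.succ - u k.succ.succ) := by
      rw [Fin.sum_univ_succ]
      simp [Fin.succ_le_succ_iff]
    have h0 : (∑ j, if (0 : Fin (m + 1)).succ ≤ j then a j else 0) =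
        ∑ j : Fin (m + 1), a j.succ := by
      rw [Fin.sum_univ_succ, if_neg (by simp), zero_add]
      exact Finset.sum_congr rfl fun j _ => if_pos (Fin.succ_le_succ_iff.2 (Fin.zero_le j))
    rw [Finset.sum_congr rfl fun k _ => hterm k, ih', h0, Fin.castSucc_zero,
      Fin.sum_univ_succ fun k => a k * (u 0 - u k), sub_self, mul_zero, zero_add, Finset.sum_mul,
      ← Finset.sum_add_distrib]
    refine Finset.sum_congr rfl fun k _ => ?_
    ring

/-- The integrand of the right-hand side on typical realizations. -/
lemma jointIntegrand_eq {m : ℕ} (s : Fin (m + 1) → ℝ) {x : Path (m + 1)} (hx : x.IsTypical) :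
    jointIntegrand s x = (1 - Real.exp (-(∑ i, s i) * x.time 1)) *
      Real.exp (-∑ k, s k * (x.lastDelay k - x.lastTime k)) := by
  -- The source of the point at the origin attains the maximal last time, `0`, and `η` lists the
  -- last times in decreasing order. Ties are harmless here.
  have h0 : x.lastTime (x.eta 0) = 0 := by
    refine le_antisymm (hx.lastTime_nonpos _) ?_
    have hmono : Monotone ((fun k => -x.lastTime k) ∘ x.eta) := Tuple.monotone_sort _
    have := hmono (Fin.zero_le (x.eta.symm (x.source 0)))
    simp only [Function.comp_apply, Equiv.apply_symm_apply, hx.lastTime_source_zero] at this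
    linarith
  rw [jointIntegrand, mul_assoc, ← Real.exp_sum, ← Real.exp_add]
  congr 2
  rw [← Equiv.sum_comp x.eta fun k => s k * (x.lastDelay k - x.lastTime k)]
  have habel := sum_sum_Ici_mul_sub (fun j => s (x.eta j)) fun j => x.lastTime (x.eta j)
  simp only [h0, zero_sub, mul_neg, Finset.sum_neg_distrib] at habel
  simp_rw [mul_sub (s _) (x.lastDelay _)]
  rw [Finset.sum_sub_distrib, Finset.sum_sub_distrib, habel,
    Fin.sum_univ_castSucc fun k => s (x.eta k) * x.lastDelay (x.eta k)]
  simp only [neg_mul, Finset.sum_neg_distrib]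
  ring

/-! ### Campbell measure and its product form -/

section Law

variable {Ω : Type*} [MeasurableSpace Ω] {K : ℕ} {P : Measure Ω} {X : Ω → Path K}

/-- The law of the realizations seen from the points in `(0, 1]`, not normalized. -/
noncomputable def palmMass (P : Measure Ω) (X : Ω → Path K) : Measure (Path K) :=
  Measure.sum fun n : ℤ =>
    (P.restrict {ω | (X ω).time n ∈ Set.Ioc 0 1}).map fun ω => (X ω).recenter n

/-- The joint law of the points and the realizations seen from them. -/
noncomputable def pointLaw (P : Measure Ω) (X : Ω → Path K) : Measure (ℝ × Path K) :=
  Measure.sum fun n : ℤ => P.map fun ω => ((X ω).time n, (X ω).recenter n)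

lemma palm_univ (P : Measure Ω) (X : Ω → Path K) :
    palm P X Set.univ = (intensity P X Set.univ)⁻¹ • palmMass P X := by
  simp [palm, palmMass]

lemma intensity_eq_tsum (hX : Measurable X) (I : Set (Fin K)) :
    intensity P X I = ∑' n : ℤ, P {ω | (X ω).time n ∈ Set.Ioc 0 1 ∧ (X ω).source n ∈ I} := by
  have hm (n : ℤ) : MeasurableSet {ω | (X ω).time n ∈ Set.Ioc (0 : ℝ) 1 ∧ (X ω).source n ∈ I} :=
    (((Path.measurable_time n).comp hX) measurableSet_Ioc).inter
      (((Path.measurable_source n).comp hX) (Set.toFinite I).measurableSet)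
  classical
  have h (ω : Ω) : (X ω).pointMeasure I (Set.Ioc 0 1) = ∑' n : ℤ,
      {ω | (X ω).time n ∈ Set.Ioc (0 : ℝ) 1 ∧ (X ω).source n ∈ I}.indicator 1 ω := by
    rw [Path.pointMeasure, Measure.sum_apply _ measurableSet_Ioc]
    rw [← tsum_subtype_eq_of_support_subset (s := {n : ℤ | (X ω).source n ∈ I})]
    · refine tsum_congr fun n => ?_
      have := n.2
      rw [Measure.dirac_apply' _ measurableSet_Ioc]
      have hiff : ω ∈ {ω | (X ω).time n ∈ Set.Ioc (0 : ℝ) 1 ∧ (X ω).source n ∈ I} ↔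
          (X ω).time n ∈ Set.Ioc (0 : ℝ) 1 := and_iff_left this
      simp only [Set.indicator_apply, hiff, Pi.one_apply]
    · intro n hn
      by_contra h'
      exact hn (Set.indicator_of_notMem (fun h => h' h.2) _)
  simp_rw [intensity, h]
  rw [lintegral_tsum fun n => (measurable_one.indicator (hm n)).aemeasurable]
  exact tsum_congr fun n => lintegral_indicator_one (hm n)

lemma measurable_time_recenter (hX : Measurable X) (n : ℤ) :
    Measurable fun ω => ((X ω).time n, (X ω).recenter n) :=
  ((Path.measurable_time n).comp hX).prodMk ((Path.measurable_recenter n).comp hX)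

lemma palmMass_apply (hX : Measurable X) {A : Set (Path K)} (hA : MeasurableSet A) :
    palmMass P X A = ∑' n : ℤ, P {ω | (X ω).time n ∈ Set.Ioc 0 1 ∧ (X ω).recenter n ∈ A} := by
  rw [palmMass, Measure.sum_apply _ hA]
  refine tsum_congr fun n => ?_
  have hm : Measurable fun ω => (X ω).recenter n := (Path.measurable_recenter n).comp hX
  rw [Measure.map_apply hm hA, Measure.restrict_apply (hm hA), Set.inter_comm]
  rfl

lemma pointLaw_prod_apply (hX : Measurable X) {B : Set ℝ} (hB : MeasurableSet B)
    {A : Set (Path K)} (hA : MeasurableSet A) :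
    pointLaw P X (B ×ˢ A) = ∑' n : ℤ, P {ω | (X ω).time n ∈ B ∧ (X ω).recenter n ∈ A} := by
  rw [pointLaw, Measure.sum_apply _ (hB.prod hA)]
  refine tsum_congr fun n => ?_
  rw [Measure.map_apply (measurable_time_recenter hX n) (hB.prod hA)]
  rfl

lemma pointLaw_prod_Ioc (hX : Measurable X) {A : Set (Path K)} (hA : MeasurableSet A) :
    pointLaw P X (Set.Ioc 0 1 ×ˢ A) = palmMass P X A := by
  rw [pointLaw_prod_apply hX measurableSet_Ioc hA, palmMass_apply hX hA]

lemma palmMass_univ (hX : Measurable X) : palmMass P X Set.univ = intensity P X Set.univ := by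
  rw [palmMass_apply hX .univ, intensity_eq_tsum hX]
  simp

/-- The point process of the points from which the realization is seen in `A` has a
translation-invariant intensity measure. -/
lemma IsStationarySystem.pointLaw_prod_preimage_add (hX : IsStationarySystem P X) (t : ℝ)
    {B : Set ℝ} (hB : MeasurableSet B) {A : Set (Path K)} (hA : MeasurableSet A) :
    pointLaw P X (((fun u => t + u) ⁻¹' B) ×ˢ A) = pointLaw P X (B ×ˢ A) := by
  have hS (C : Set ℝ) (hC : MeasurableSet C) (n : ℤ) :
      MeasurableSet {x : Path K | x.time n ∈ C ∧ x.recenter n ∈ A} :=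
    (Path.measurable_time n hC).inter (Path.measurable_recenter n hA)
  let F (C : Set ℝ) (x : Path K) : ℝ≥0∞ :=
    ∑' n : ℤ, {x : Path K | x.time n ∈ C ∧ x.recenter n ∈ A}.indicator 1 x
  have hF (C : Set ℝ) (hC : MeasurableSet C) : Measurable (F C) :=
    Measurable.tsum fun n => measurable_one.indicator (hS C hC n)
  have hlaw (C : Set ℝ) (hC : MeasurableSet C) :
      pointLaw P X (C ×ˢ A) = ∫⁻ ω, F C (X ω) ∂P := by
    rw [pointLaw_prod_apply hX.measurable hC hA]
    refine Eq.trans ?_ (lintegral_tsum fun n =>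
      ((measurable_one.indicator (hS C hC n)).comp hX.measurable).aemeasurable).symm
    refine tsum_congr fun n => ?_
    exact (lintegral_indicator_one (hX.measurable (hS C hC n))).symm
  have hB' : MeasurableSet ((fun u => t + u) ⁻¹' B) := measurable_const_add t hB
  have hshift (x : Path K) : F ((fun u => t + u) ⁻¹' B) (x.shift t) = F B x := by
    -- The shift only renumbers the points by `count t`, and a sum over all points does not see the
    -- numbering.
    refine Eq.trans ?_ ((Equiv.addLeft (x.count t)).tsum_eq fun n : ℤ =>
      {x : Path K | x.time n ∈ B ∧ x.recenter n ∈ A}.indicator (1 : Path K → ℝ≥0∞) x)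
    refine tsum_congr fun n => ?_
    have hiff : x.shift t ∈ {x : Path K | x.time n ∈ (fun u => t + u) ⁻¹' B ∧ x.recenter n ∈ A} ↔
        x ∈ {x : Path K | x.time (x.count t + n) ∈ B ∧ x.recenter (x.count t + n) ∈ A} := by
      have : t + (x.shift t).time n = x.time (x.count t + n) := by simp [Path.shift, Path.time]
      simp only [Set.mem_ofPred_eq, Set.mem_preimage, this, Path.recenter_shift]
    classical
    simp only [Set.indicator_apply, hiff]
    rfl
  rw [hlaw _ hB', hlaw _ hB]
  refine ((hX.stationary t).comp (hF _ hB')).lintegral_eq.symm.trans ?_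
  exact lintegral_congr fun ω => hshift (X ω)

lemma IsStationarySystem.pointLaw_eq_prod (hX : IsStationarySystem P X) :
    pointLaw P X = (volume : Measure ℝ).prod (palmMass P X) := by
  have hfin : IsFiniteMeasure (palmMass P X) :=
    ⟨by rw [palmMass_univ hX.measurable]; exact hX.intensity_lt_top⟩
  refine (Measure.prod_eq fun B A hB hA => ?_).symm
  let μ : Measure ℝ := ((pointLaw P X).restrict (Set.univ ×ˢ A)).map Prod.fst
  have hμ (C : Set ℝ) (hC : MeasurableSet C) : μ C = pointLaw P X (C ×ˢ A) := by
    rw [Measure.map_apply measurable_fst hC, Measure.restrict_apply (measurable_fst hC)]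
    congr 1
    ext p
    simp
  have hinv : μ.IsAddLeftInvariant := ⟨fun t => by
    ext C hC
    rw [Measure.map_apply (measurable_const_add t) hC, hμ _ (measurable_const_add t hC), hμ C hC,
      hX.pointLaw_prod_preimage_add t hC hA]⟩
  have hIoc : μ (Set.Ioc 0 1) = palmMass P X A := by
    rw [hμ _ measurableSet_Ioc, pointLaw_prod_Ioc hX.measurable hA]
  -- Finite mass on one nonempty open set suffices for an invariant measure. Uniqueness of Haar
  -- measure then applies, and `(0, 1]` fixes the constant.
  have hcomp : IsFiniteMeasureOnCompacts μ := ⟨fun C hC =>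
    measure_lt_top_of_isCompact_of_isAddLeftInvariant (Set.Ioo 0 1) isOpen_Ioo
      ⟨1 / 2, by norm_num⟩ ((measure_mono Set.Ioo_subset_Ioc_self).trans_lt
        (hIoc ▸ measure_lt_top _ _)).ne hC⟩
  obtain ⟨c, hc⟩ : ∃ c : NNReal, μ = c • volume := ⟨_, Measure.isAddLeftInvariant_eq_smul μ volume⟩
  rw [← hμ B hB, ← hIoc, hc, Measure.smul_apply, Measure.smul_apply, Real.volume_Ioc, sub_zero,
    ENNReal.ofReal_one, ENNReal.smul_def, ENNReal.smul_def, smul_eq_mul, smul_eq_mul, mul_one,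
    mul_comm]

end Law

/-! ### Palm-almost-sure typicality and Palm inversion -/

section Law

variable {Ω : Type*} [MeasurableSpace Ω] {K : ℕ} {P : Measure Ω} {X : Ω → Path K}

lemma ae_palmMass_of_ae (hX : Measurable X) {A : Set (Path K)} (hA : MeasurableSet A)
    (h : ∀ᵐ ω ∂P, ∀ n, (X ω).recenter n ∈ A) : ∀ᵐ x ∂palmMass P X, x ∈ A := by
  change palmMass P X Aᶜ = 0
  rw [palmMass_apply hX hA.compl, ENNReal.tsum_eq_zero]
  intro n
  refine measure_mono_null (fun ω hω => ?_) (ae_iff.1 h)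
  exact fun hω' => hω.2 (hω' n)

/-- The event `E t` that source `k` has no point up to `t` has a probability independent of `t`. As
`t → ∞` it decreases to the null event that source `k` has no point at all. -/
lemma IsStationarySystem.ae_exists_source_le [IsFiniteMeasure P] (hX : IsStationarySystem P X)
    {k : Fin K} (hne : ∀ᵐ ω ∂P, ∃ n : ℤ, (X ω).source n = k) (t : ℝ) :
    ∀ᵐ ω ∂P, ∃ n, (X ω).source n = k ∧ (X ω).time n ≤ t := by
  let E (t : ℝ) : Set (Path K) := ⋂ n, {x | x.source n = k ∧ x.time n ≤ t}ᶜ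
  have hE (t : ℝ) : MeasurableSet (E t) := MeasurableSet.iInter fun n =>
    ((Path.measurable_source n (measurableSet_singleton k)).inter
      (Path.measurable_time n measurableSet_Iic)).compl
  have hmem (t : ℝ) (x : Path K) : x ∈ E t ↔ ¬ ∃ n, x.source n = k ∧ x.time n ≤ t := by
    simp [E]
  have hshift (t : ℝ) (x : Path K) : x.shift t ∈ E 0 ↔ x ∈ E t := by
    rw [hmem, hmem, not_iff_not]
    refine (Equiv.addLeft (x.count t)).exists_congr fun n => ?_
    exact and_congr_right fun _ => sub_nonpos
  have hconst (t : ℝ) : P (X ⁻¹' E t) = P (X ⁻¹' E 0) := by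
    rw [← (hX.stationary t).measure_mem_eq (hE 0)]
    congr 1
    ext ω
    exact (hshift t (X ω)).symm
  have hlim : Filter.Tendsto (fun N : ℕ => P (X ⁻¹' E N)) Filter.atTop
      (nhds (P (⋂ N : ℕ, X ⁻¹' E N))) := by
    refine tendsto_measure_iInter_atTop (fun N => (hX.measurable (hE N)).nullMeasurableSet) ?_
      ⟨0, measure_ne_top _ _⟩
    intro N M hNM ω hω
    refine (hmem _ _).2 fun ⟨n, hn, hn'⟩ => (hmem _ _).1 hω ⟨n, hn, hn'.trans ?_⟩
    exact_mod_cast hNM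
  have hzero : P (⋂ N : ℕ, X ⁻¹' E N) = 0 := by
    refine measure_mono_null (fun ω hω => ?_) hne
    rintro ⟨n, hn⟩
    obtain ⟨N, hN⟩ := exists_nat_ge ((X ω).time n)
    exact (hmem _ _).1 (Set.mem_iInter.1 hω N) ⟨n, hn, hN⟩
  simp_rw [hconst, hzero] at hlim
  have h0 : P (X ⁻¹' E t) = 0 := (hconst t).trans (tendsto_nhds_unique tendsto_const_nhds hlim)
  refine measure_mono_null (fun ω hω => ?_) h0
  exact (hmem _ _).2 hω

lemma palm_source_univ (hX : IsStationarySystem P X) (k : Fin K) :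
    intensity P X {k} ≠ ∞ ∧ palm P X {k} Set.univ = 1 := by
  have htop : intensity P X {k} ≠ ∞ := by
    refine ne_top_of_le_ne_top hX.intensity_lt_top.ne ?_
    rw [intensity_eq_tsum hX.measurable, intensity_eq_tsum hX.measurable]
    exact ENNReal.tsum_le_tsum fun n => measure_mono fun ω hω => ⟨hω.1, trivial⟩
  have huniv : palm P X {k} Set.univ = (intensity P X {k})⁻¹ * intensity P X {k} := by
    rw [palm, Measure.smul_apply, Measure.sum_apply _ .univ, intensity_eq_tsum hX.measurable,
      smul_eq_mul]
    congr 1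
    refine tsum_congr fun n => ?_
    have hm : Measurable fun ω => (X ω).recenter n :=
      (Path.measurable_recenter n).comp hX.measurable
    rw [Measure.map_apply hm .univ, Set.preimage_univ, Measure.restrict_apply_univ]
  refine ⟨htop, ?_⟩
  rw [huniv]
  -- With zero intensity the total mass would be `∞ * 0 = 0`, contradicting `delay_finite`.
  refine ENNReal.inv_mul_cancel (fun h0 => ?_) htop
  have h1 : palm P X {k} {x | x.delay 0 < ∞} ≤ 0 :=
    (measure_mono (Set.subset_univ _)).trans_eq (by rw [huniv, h0, mul_zero])
  rw [hX.delay_finite k] at h1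
  exact one_ne_zero (le_antisymm h1 zero_le)

/-- Palm-nullity only controls points in `(0, 1]`. The product form extends it to the whole line,
since `volume univ * 0 = 0`. -/
lemma IsStationarySystem.ae_delay_lt_top (hX : IsStationarySystem P X) :
    ∀ᵐ ω ∂P, ∀ n, (X ω).delay n < ∞ := by
  have hD (k : Fin K) : MeasurableSet {x : Path K | x.source 0 = k ∧ ¬ x.delay 0 < ∞} :=
    (Path.measurable_source 0 (measurableSet_singleton k)).inter
      (Path.measurable_delay 0 measurableSet_Iio).compl
  have hnull (k : Fin K) : palmMass P X {x | x.source 0 = k ∧ ¬ x.delay 0 < ∞} = 0 := by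
    obtain ⟨htop, huniv⟩ := palm_source_univ hX k
    have : IsProbabilityMeasure (palm P X {k}) := ⟨huniv⟩
    have hG : MeasurableSet {x : Path K | x.delay 0 < ∞} :=
      Path.measurable_delay 0 measurableSet_Iio
    have h0 := (prob_compl_eq_zero_iff hG).2 (hX.delay_finite k)
    rw [palm, Measure.smul_apply, smul_eq_mul, mul_eq_zero, ENNReal.inv_eq_zero,
      or_iff_right htop, Measure.sum_apply _ hG.compl, ENNReal.tsum_eq_zero] at h0
    rw [palmMass_apply hX.measurable (hD k), ENNReal.tsum_eq_zero]
    intro n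
    have hm : Measurable fun ω => (X ω).recenter n :=
      (Path.measurable_recenter n).comp hX.measurable
    have hn := h0 n
    rw [Measure.map_apply hm hG.compl, Measure.restrict_apply (hm hG.compl)] at hn
    refine measure_mono_null (fun ω hω => ?_) hn
    refine ⟨hω.2.2, hω.1, ?_⟩
    have := hω.2.1
    simpa [Path.recenter, Path.source] using this
  have hpoint (k : Fin K) (n : ℤ) :
      P {ω | (X ω).time n ∈ Set.univ ∧
        (X ω).recenter n ∈ {x | x.source 0 = k ∧ ¬ x.delay 0 < ∞}} = 0 := by
    have hfin : IsFiniteMeasure (palmMass P X) :=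
      ⟨by rw [palmMass_univ hX.measurable]; exact hX.intensity_lt_top⟩
    have := pointLaw_prod_apply (P := P) hX.measurable .univ (hD k)
    rw [hX.pointLaw_eq_prod, Measure.prod_prod, hnull, mul_zero] at this
    exact ENNReal.tsum_eq_zero.1 this.symm n
  refine ae_all_iff.2 fun n => ?_
  refine measure_mono_null (fun ω hω => ?_) (measure_iUnion_null fun k => hpoint k n)
  refine Set.mem_iUnion.2 ⟨(X ω).source n, trivial, ?_, ?_⟩
  · simp [Path.recenter, Path.source]
  · have : ¬ (X ω).delay n < ∞ := hω
    simpa [Path.recenter, Path.delay] using this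

lemma IsStationarySystem.ae_palmMass_isTypical [IsFiniteMeasure P] (hX : IsStationarySystem P X)
    (hne : ∀ k : Fin K, ∀ᵐ ω ∂P, ∃ n : ℤ, (X ω).source n = k) :
    ∀ᵐ x ∂palmMass P X, x.IsTypical := by
  refine ae_palmMass_of_ae hX.measurable Path.measurableSet_isTypical ?_
  -- Integer thresholds keep the exceptional set null while still reaching below every random point
  -- `U_n`.
  have h : ∀ᵐ ω ∂P, ∀ k, ∀ N : ℕ, ∃ n, (X ω).source n = k ∧ (X ω).time n ≤ -N :=
    ae_all_iff.2 fun k => ae_all_iff.2 fun N => hX.ae_exists_source_le (hne k) _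
  filter_upwards [h, hX.simple, hX.ae_delay_lt_top] with ω hsrc hnum hdel n
  refine ⟨sub_eq_zero.2 (by simp), fun i j hij => ?_, fun k => ?_, fun j => hdel _⟩
  · exact sub_lt_sub_right (hnum.strictMono (by lia)) _
  · obtain ⟨N, hN⟩ := exists_nat_ge (-(X ω).time n)
    obtain ⟨j, hj, hj'⟩ := hsrc k N
    refine ⟨j - n, ?_, ?_⟩
    · simpa [Path.recenter, Path.source] using hj
    · change (X ω).time (n + (j - n)) - (X ω).time n ≤ 0
      rw [add_sub_cancel]
      linarith

/-- The Palm inversion formula. -/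
lemma IsStationarySystem.lintegral_eq_lintegral_palmMass (hX : IsStationarySystem P X)
    {g : Path K → ℝ≥0∞} (hg : Measurable g) :
    ∫⁻ ω, g (X ω) ∂P =
      ∫⁻ x, (∫⁻ t in Set.Ioc (-x.time 1) 0, g (x.translate t)) ∂palmMass P X := by
  have hfin : IsFiniteMeasure (palmMass P X) :=
    ⟨by rw [palmMass_univ hX.measurable]; exact hX.intensity_lt_top⟩
  let S : Set (ℝ × Path K) := {p | p.1 ∈ Set.Ioc (-p.2.time 1) 0}
  have hS : MeasurableSet S :=
    (measurableSet_lt ((Path.measurable_time 1).comp measurable_snd).neg measurable_fst).inter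
      (measurableSet_le measurable_fst measurable_const)
  let H : ℝ × Path K → ℝ≥0∞ := S.indicator fun p => g (p.2.translate p.1)
  have hH : Measurable H := (hg.comp Path.measurable_translate).indicator hS
  have hl : ∫⁻ p, H p ∂pointLaw P X = ∫⁻ ω, g (X ω) ∂P := by
    rw [pointLaw, lintegral_sum_measure]
    simp_rw [fun n => lintegral_map (μ := P) hH (measurable_time_recenter hX.measurable n)]
    refine (lintegral_tsum fun n => (hH.comp
      (measurable_time_recenter hX.measurable n)).aemeasurable).symm.trans ?_
    refine lintegral_congr_ae ?_
    filter_upwards [hX.simple] with ω hω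
    have htime (n : ℤ) : ((X ω).recenter n).time 1 = (X ω).time (n + 1) - (X ω).time n := rfl
    -- Membership in `S` says `U_n ≤ 0 < U_{n+1}`, which forces `n = 0`.
    rw [tsum_eq_single 0]
    · have hmem : ((X ω).time 0, (X ω).recenter 0) ∈ S := by
        refine ⟨?_, hω.nonpos⟩
        have := hω.pos
        simp only [htime, zero_add]
        linarith
      change H ((X ω).time 0, (X ω).recenter 0) = _
      simp only [H, Set.indicator_of_mem hmem, Path.translate_recenter_zero]
    · intro n hn
      change H ((X ω).time n, (X ω).recenter n) = 0
      refine Set.indicator_of_notMem (fun hmem => ?_) _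
      obtain ⟨h1, h2⟩ := hmem
      simp only [htime] at h1 h2
      rcases lt_or_gt_of_ne hn with h | h
      · have := hω.strictMono.monotone (show n + 1 ≤ 0 by lia)
        linarith [hω.nonpos]
      · have := hω.strictMono.monotone (show 1 ≤ n by lia)
        linarith [hω.pos]
  rw [← hl, hX.pointLaw_eq_prod, lintegral_prod_symm' _ hH]
  refine lintegral_congr fun x => ?_
  rw [← lintegral_indicator measurableSet_Ioc]
  rfl

end Law

/-! ### Integration over one inter-point interval -/

lemma setIntegral_exp_mul {c : ℝ} (hc : c ≠ 0) {b : ℝ} (hb : 0 ≤ b) :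
    ∫ t in Set.Ioc (-b) 0, Real.exp (c * t) = c⁻¹ * (1 - Real.exp (-c * b)) := by
  rw [← intervalIntegral.integral_of_le (by linarith),
    intervalIntegral.integral_comp_mul_left _ hc, integral_exp]
  simp

/-- The age functional integrated over the interval until the next point. -/
lemma Path.IsTypical.setLIntegral_translate {m : ℕ} {s : Fin (m + 1) → ℝ} (hs : ∑ k, s k ≠ 0)
    {x : Path (m + 1)} (hx : x.IsTypical) :
    0 ≤ (∑ k, s k)⁻¹ * jointIntegrand s x ∧
    ∫⁻ t in Set.Ioc (-x.time 1) 0,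
      ENNReal.ofReal (Real.exp (-∑ k, s k * ((x.translate t).age k 0).toReal)) =
    ENNReal.ofReal ((∑ k, s k)⁻¹ * jointIntegrand s x) := by
  have h1 : 0 ≤ x.time 1 := hx.time_zero ▸ hx.strictMono.monotone zero_le_one
  have hexp : ∀ t ∈ Set.Ioc (-x.time 1) 0,
      Real.exp (-∑ k, s k * ((x.translate t).age k 0).toReal) =
        Real.exp (-∑ k, s k * (x.lastDelay k - x.lastTime k)) * Real.exp ((∑ k, s k) * t) := by
    intro t ht
    rw [← Real.exp_add, Finset.sum_mul, ← Finset.sum_neg_distrib, ← Finset.sum_neg_distrib,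
      ← Finset.sum_add_distrib]
    congr 1
    refine Finset.sum_congr rfl fun k _ => ?_
    rw [hx.toReal_age_translate k ht.2 (by linarith [ht.1])]
    ring
  have hint : (∑ k, s k)⁻¹ * jointIntegrand s x = ∫ t in Set.Ioc (-x.time 1) 0,
      Real.exp (-∑ k, s k * (x.lastDelay k - x.lastTime k)) * Real.exp ((∑ k, s k) * t) := by
    rw [integral_const_mul, setIntegral_exp_mul hs h1, jointIntegrand_eq s hx]
    ring
  rw [hint]
  refine ⟨integral_nonneg fun t => by positivity, ?_⟩
  rw [ofReal_integral_eq_lintegral_ofReal]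
  · refine setLIntegral_congr_fun measurableSet_Ioc fun t ht => ?_
    simp only [hexp t ht]
  · exact ((by fun_prop : Continuous fun t : ℝ => Real.exp (-∑ k, s k *
      (x.lastDelay k - x.lastTime k)) * Real.exp ((∑ k, s k) * t)).integrableOn_Icc
        (a := -x.time 1) (b := 0)).mono_set Set.Ioc_subset_Icc_self
  · exact Filter.Eventually.of_forall fun t => by positivity

lemma measurable_exp_neg_sum_age {K : ℕ} (s : Fin K → ℝ) :
    Measurable fun x : Path K => Real.exp (-∑ k, s k * (x.age k 0).toReal) :=
  (Finset.measurable_fun_sum _ fun k _ =>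
    (Path.measurable_age k 0).ennreal_toReal.const_mul (s k)).neg.exp

/-- On typical realizations the integrand can be written through the ages, so measurability of `eta`
is never needed. -/
lemma aestronglyMeasurable_jointIntegrand {m : ℕ} (s : Fin (m + 1) → ℝ)
    {μ : Measure (Path (m + 1))} (hμ : ∀ᵐ x ∂μ, x.IsTypical) :
    AEStronglyMeasurable (jointIntegrand s) μ := by
  have hmeas : Measurable fun x : Path (m + 1) => (1 - Real.exp (-(∑ i, s i) * x.time 1)) *
      Real.exp (-∑ k, s k * (x.age k 0).toReal) :=
    (measurable_const.sub ((Path.measurable_time 1).const_mul _).exp).mul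
      (measurable_exp_neg_sum_age s)
  refine hmeas.aestronglyMeasurable.congr ?_
  filter_upwards [hμ] with x hx
  rw [jointIntegrand_eq s hx]
  have hx0 : x.translate 0 = x := by
    funext n
    simp [Path.translate, Path.time, Path.source, Path.delay]
  have h1 : 0 < x.time 1 := hx.time_zero ▸ hx.strictMono zero_lt_one
  have hage (k : Fin (m + 1)) : (x.age k 0).toReal = x.lastDelay k - x.lastTime k := by
    have := hx.toReal_age_translate k le_rfl (by linarith : 0 < x.time 1 + 0)
    rwa [hx0, sub_zero] at this
  simp_rw [hage]

end AoI

theorem mainTheorem2 {Ω : Type*} [MeasurableSpace Ω] (P : Measure Ω) [IsProbabilityMeasure P]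
    (m : ℕ) (X : Ω → AoI.Path (m + 1)) (hX : AoI.IsStationarySystem P X)
    (hne : ∀ k : Fin (m + 1), ∀ᵐ ω ∂P, ∃ n : ℤ, (X ω).source n = k)
    (s : Fin (m + 1) → ℝ) :
    ((∑ k, s k) ≠ 0 →
      (Integrable (fun ω => Real.exp (-∑ k, s k * ((X ω).age k 0).toReal)) P ↔
        Integrable (AoI.jointIntegrand s) (AoI.palm P X Set.univ))) ∧
    (Integrable (AoI.jointIntegrand s) (AoI.palm P X Set.univ) →
      (∑ k, s k) * ∫ ω, Real.exp (-∑ k, s k * ((X ω).age k 0).toReal) ∂P =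
        (AoI.intensity P X Set.univ).toReal *
          ∫ x, AoI.jointIntegrand s x ∂(AoI.palm P X Set.univ)) := by
  by_cases hs : ∑ k, s k = 0
  · refine ⟨fun h => absurd hs h, fun _ => ?_⟩
    have : AoI.jointIntegrand s = fun _ => 0 := by
      funext x
      simp [AoI.jointIntegrand, hs]
    simp [this, hs]
  set lam := AoI.intensity P X Set.univ with hlam
  have hlam0 : lam ≠ 0 := hX.intensity_pos.ne'
  have hlamt : lam ≠ ∞ := hX.intensity_lt_top.ne
  set Q := AoI.palm P X Set.univ with hQ
  have hmass : AoI.palmMass P X = lam • Q := by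
    rw [hQ, AoI.palm_univ, smul_smul, ENNReal.mul_inv_cancel hlam0 hlamt, one_smul]
  have htyp := hX.ae_palmMass_isTypical hne
  have htypQ : ∀ᵐ x ∂Q, x.IsTypical := by
    rw [hQ, AoI.palm_univ]
    exact Measure.ae_smul_measure htyp _
  have hmeasJ := AoI.aestronglyMeasurable_jointIntegrand s htypQ
  have hmeasE : Measurable fun ω => Real.exp (-∑ k, s k * ((X ω).age k 0).toReal) :=
    (AoI.measurable_exp_neg_sum_age s).comp hX.measurable
  have hpos : 0 ≤ᵐ[Q] fun x => (∑ k, s k)⁻¹ * AoI.jointIntegrand s x := by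
    filter_upwards [htypQ] with x hx using (hx.setLIntegral_translate hs).1
  have key : ∫⁻ ω, ENNReal.ofReal (Real.exp (-∑ k, s k * ((X ω).age k 0).toReal)) ∂P =
      lam * ∫⁻ x, ENNReal.ofReal ((∑ k, s k)⁻¹ * AoI.jointIntegrand s x) ∂Q := by
    rw [hX.lintegral_eq_lintegral_palmMass (g := fun x => ENNReal.ofReal
      (Real.exp (-∑ k, s k * (x.age k 0).toReal)))
      (AoI.measurable_exp_neg_sum_age s).ennreal_ofReal, ← smul_eq_mul, ← lintegral_smul_measure,
      ← hmass]
    refine lintegral_congr_ae ?_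
    filter_upwards [htyp] with x hx using (hx.setLIntegral_translate hs).2
  refine ⟨fun _ => ?_, fun _ => ?_⟩
  -- The factor `s̄⁻¹` makes the integrand nonnegative, so integrability on each side means a finite
  -- `lintegral` in `key`.
  · rw [← integrable_const_mul_iff (IsUnit.mk0 _ (inv_ne_zero hs)) (AoI.jointIntegrand s),
      ← lintegral_ofReal_ne_top_iff_integrable (hmeasJ.const_mul _) hpos,
      ← lintegral_ofReal_ne_top_iff_integrable hmeasE.aestronglyMeasurable
        (Filter.Eventually.of_forall fun ω => (Real.exp_pos _).le)]
    rw [key, ne_eq, ENNReal.mul_eq_top]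
    simp [hlam0, hlamt]
  · rw [integral_eq_lintegral_of_nonneg_ae
      (Filter.Eventually.of_forall fun ω => (Real.exp_pos _).le) hmeasE.aestronglyMeasurable]
    rw [key, ENNReal.toReal_mul,
      ← integral_eq_lintegral_of_nonneg_ae hpos (hmeasJ.const_mul _), integral_const_mul]
    field_simp
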